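/- Theorem 3.2 (label dcompatible). All graphs are finite and simple. For a vertex $v$ of a graph $G$, let $N_G(v)$ be the set of neighbours of $v$; $v$ is called free if the vertices in $N_G(v)$ are pairwise adjacent, and non-free otherwise. Let $G-v$ be the subgraph induced on $V(G)\setminus\{v\}$, and let $G_v$ be the graph on $V(G)$ with edge set $E(G)\cup\{\{u,w\} : u,w\in N_G(v),\ u\neq w\}$. A map $\psi$ from the set of all graphs to $\mathbb{N}_0$ is called $d$-compatible if (a) whenever $G$ is isomorphic to a disjoint union $K_{n_1}\,\dot\cup\,\cdots\,\dot\cup\,K_{n_t}$ of complete graphs with $t\ge 0$ and all $n_i\ge 1$, one has $\psi(G)\le t+\sum_{i=1}^t n_i$; (b) whenever $G$ is not isomorphic to such a disjoint union, there is a non-free vertex $v\in V(G)$ such that $\psi(G-v)\ge\psi(G)$, $\psi(G_v)\ge\psi(G)$ and $\psi(G_v-v)\ge\psi(G)-1$. Let $K$ be a field, let $G$ be a graph with vertex set $V$, let $S=K[x_v,y_v : v\in V]$, let $\mathfrak m=(x_v,y_v : v\in V)$, and let $J_G\subseteq S$ be the binomial edge ideal of $G$, that is, the ideal generated by the binomials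 $x_iy_j-x_jy_i$ for all edges $\{i,j\}$ of $G$. Then for every $d$-compatible map $\psi$, $$\operatorname{depth} S/J_G\ \ge\ \psi(G),$$ where $\operatorname{depth} S/J_G=\min\{i : H^i_{\mathfrak m}(S/J_G)\neq 0\}$ and $H^i_{\mathfrak m}$ denotes local cohomology with support in $\mathfrak m$. -/

import Mathlib

open CategoryTheory

universe u v w

noncomputable section

namespace BinomialEdge

/-- The polynomial ring `K[x_v, y_v : v ∈ V]`: the variable `x_v` is indexed by `Sum.inl v` and
the variable `y_v` by `Sum.inr v`. -/
abbrev PolyRing (K : Type w) [Field K] (V : Type u) : Type (max u w) :=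
  MvPolynomial (V ⊕ V) K

/-- The variable `x_i`. -/
def x (K : Type w) [Field K] {V : Type u} (i : V) : PolyRing K V :=
  MvPolynomial.X (Sum.inl i)

/-- The variable `y_i`. -/
def y (K : Type w) [Field K] {V : Type u} (i : V) : PolyRing K V :=
  MvPolynomial.X (Sum.inr i)

/-- The binomial edge ideal `J_G`, generated by the binomials `x_i y_j - x_j y_i` for the edges
`{i, j}` of `G`. (Exchanging `i` and `j` only changes the sign of the binomial, so no order on the
vertices is needed.) -/
def binomialEdgeIdeal (K : Type w) [Field K] {V : Type u} (G : SimpleGraph V) :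
    Ideal (PolyRing K V) :=
  Ideal.span {f | ∃ i j : V, G.Adj i j ∧ f = x K i * y K j - x K j * y K i}

/-- The maximal homogeneous ideal `𝔪 = (x_v, y_v : v ∈ V)`. -/
def maximalHomogeneousIdeal (K : Type w) [Field K] (V : Type u) : Ideal (PolyRing K V) :=
  Ideal.span (Set.range MvPolynomial.X)

/-- The depth of a module `M` with respect to an ideal `I`: the least `i` such that the local
cohomology module `H^i_I(M)` is nonzero (and `⊤` if there is no such `i`). -/
def depth {R : Type v} [CommRing R] (I : Ideal R) (M : Type v) [AddCommGroup M] [Module R M] :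
    ℕ∞ :=
  sInf {d : ℕ∞ | ∃ i : ℕ, d = i ∧
    ¬ Limits.IsZero ((localCohomology I i).obj (ModuleCat.of R M))}

/-- A vertex is free (simplicial) if its neighbours are pairwise adjacent. -/
def IsFreeVertex {V : Type u} (G : SimpleGraph V) (v : V) : Prop :=
  G.IsClique (G.neighborSet v)

/-- The graph `G - v`: the induced subgraph on the vertices other than `v`. -/
def deleteVertex {V : Type u} (G : SimpleGraph V) (v : V) :
    SimpleGraph ({v}ᶜ : Set V) :=
  G.induce {v}ᶜ

/-- The graph `G_v`: same vertices as `G`, and all edges between two neighbours of `v` added. -/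
def completeAt {V : Type u} (G : SimpleGraph V) (v : V) : SimpleGraph V where
  Adj a b := G.Adj a b ∨ (a ≠ b ∧ G.Adj v a ∧ G.Adj v b)
  symm := ⟨fun _ _ h => h.elim (fun h => Or.inl h.symm) fun h => Or.inr ⟨h.1.symm, h.2.2, h.2.1⟩⟩
  loopless := ⟨fun a h => h.elim (fun h => G.loopless.irrefl a h) fun h => h.1 rfl⟩

/-- The disjoint union of the complete graphs `K_{n_1}, …, K_{n_t}`: two distinct vertices are
adjacent exactly if they lie in the same summand. -/
def disjointUnionComplete {t : ℕ} (n : Fin t → ℕ) : SimpleGraph (Σ i, Fin (n i)) where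
  Adj a b := a ≠ b ∧ a.1 = b.1
  symm := ⟨fun _ _ h => ⟨h.1.symm, h.2.symm⟩⟩
  loopless := ⟨fun _ h => h.1 rfl⟩

/-- `G` is (isomorphic to) the disjoint union of complete graphs `K_{n_1}, …, K_{n_t}` with all
`n_i ≥ 1`; the empty graph is the case `t = 0`. -/
def IsDisjointUnionComplete {V : Type u} (G : SimpleGraph V) {t : ℕ} (n : Fin t → ℕ) : Prop :=
  (∀ i, 1 ≤ n i) ∧ Nonempty (G ≃g disjointUnionComplete n)

/-- A map `ψ` from finite simple graphs to `ℕ` that is `d`-compatible. -/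
structure IsDCompatible (ψ : ∀ (V : Type u) [Finite V], SimpleGraph V → ℕ) : Prop where
  le_of_disjointUnion : ∀ (V : Type u) [Finite V] (G : SimpleGraph V) (t : ℕ) (n : Fin t → ℕ),
    IsDisjointUnionComplete G n → ψ V G ≤ t + ∑ i, n i
  exists_nonfree : ∀ (V : Type u) [Finite V] (G : SimpleGraph V),
    (¬ ∃ (t : ℕ) (n : Fin t → ℕ), IsDisjointUnionComplete G n) →
      ∃ v : V, ¬ IsFreeVertex G v ∧
        ψ V G ≤ ψ _ (deleteVertex G v) ∧
        ψ V G ≤ ψ V (completeAt G v) ∧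
        ψ V G ≤ ψ _ (deleteVertex (completeAt G v) v) + 1

end BinomialEdge

end

/-! Call M good up to d if Ext^i(R/I^k, M) = 0 for all k and all i < d. Local cohomology is the
colimit of these Ext modules over k, so goodness up to d gives depth at least d, and goodness
propagates through long exact Ext sequences.

Induct on the number of non-edges. If G is not a disjoint union of complete graphs, take the
non-free vertex v from (b). Ohtani's decomposition writes J_G as the intersection of J_{G_v} and
(x_v, y_v) + J_{G-v}, whose sum is (x_v, y_v) + J_{G_v-v}. The Mayer–Vietoris sequence 0 → R/(A ∩ B)
→ R/A ⊕ R/B → R/(A + B) → 0 then gives the bound; its degree shift is exactly the -1 in (b). All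
three graphs have fewer non-edges. So that they live over one ring, a graph on a subset of V is
encoded by `embeddedIdeal`, which also contains the variables of the missing vertices.

For disjoint unions of complete graphs the bound is t + ∑ n_i. Here J_G belongs to a family of toric
prime ideals `colouredIdeal`, closed under the operations of killing a vertex or all x-variables of
a colour. Primality supplies regular elements and colon ideals, and the bound follows by removing
variables one at a time. -/

noncomputable section

namespace BinomialEdge

/-! ### Vanishing of Ext and its behaviour in short exact sequences. -/

section Homological

open Abelian Limits

variable {R : Type v} [CommRing R]

/-- The modules `Ext^i(R/I^k, M)` vanish for all `k` and all `i < d`. -/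
def ExtVanishes (I : Ideal R) (d : ℕ) (M : Type v) [AddCommGroup M] [Module R M] : Prop :=
  ∀ k i : ℕ, i < d → Subsingleton (Abelian.Ext (ModuleCat.of R (R ⧸ I ^ k)) (ModuleCat.of R M) i)

/-- Local cohomology is built from the derived functor `_root_.Ext`, whereas the long exact
sequences below concern `Abelian.Ext`. A projective resolution of X computes both: a cocycle with
zero class is a coboundary. -/
theorem isZero_ext_of_subsingleton (X Y : ModuleCat.{v} R) (n : ℕ)
    (h : Subsingleton (Abelian.Ext X Y n)) :
    IsZero (((_root_.Ext R (ModuleCat.{v} R) n).obj (Opposite.op X)).obj Y) := by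
  let P := ProjectiveResolution.of X
  refine IsZero.of_iso ?_ (P.isoExt n Y)
  rw [← HomologicalComplex.exactAt_iff_isZero_homology]
  obtain _ | n := n
  -- In degree 0 nothing bounds: a cocycle factors through the cokernel X of the resolution, and
  -- Hom(X, Y) is Ext^0, hence zero.
  · rw [HomologicalComplex.exactAt_iff' _ 0 0 1 (by simp) (by simp),
      ShortComplex.moduleCat_exact_iff]
    intro (f : P.complex.X 0 ⟶ Y) hf
    have hd : P.complex.d 1 0 ≫ f = 0 := hf
    obtain ⟨g, hg⟩ := Cofork.IsColimit.desc' P.isColimitCokernelCofork f (by rw [hd, zero_comp])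
    have hg0 : g = 0 := Abelian.Ext.addEquiv₀.symm.injective (h.elim _ _)
    refine ⟨0, ?_⟩
    rw [map_zero, ← hg, hg0]
    exact comp_zero.symm
  · rw [HomologicalComplex.exactAt_iff' _ n (n + 1) (n + 2) (by simp) (by simp),
      ShortComplex.moduleCat_exact_iff]
    intro (f : P.complex.X (n + 1) ⟶ Y) hf
    exact (P.extMk_eq_zero_iff f (n + 2) rfl hf n rfl).1 (Subsingleton.elim _ _)

/-- A colimit of zero modules is zero, and evaluation at M preserves the colimit over k that defines
H^i_I. -/
theorem ExtVanishes.le_depth {I : Ideal R} {d : ℕ} {M : Type v} [AddCommGroup M] [Module R M]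
    (h : ExtVanishes I d M) : (d : ℕ∞) ≤ depth I M := by
  refine le_sInf ?_
  rintro _ ⟨i, rfl, hi⟩
  by_contra hlt
  have hid : i < d := by simpa using hlt
  apply hi
  have hcol : IsColimit (((evaluation _ _).obj (ModuleCat.of R M)).mapCocone
      (colimit.cocone (localCohomology.diagram (localCohomology.idealPowersDiagram I) i))) :=
    isColimitOfPreserves _ (colimit.isColimit _)
  rw [IsZero.iff_id_eq_zero]
  refine hcol.hom_ext fun j => ?_
  refine IsZero.eq_of_src ?_ _ _
  exact isZero_ext_of_subsingleton _ _ _ (h _ _ hid)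

theorem ExtVanishes.mono {I : Ideal R} {d e : ℕ} {M : Type v} [AddCommGroup M] [Module R M]
    (h : ExtVanishes I d M) (hed : e ≤ d) : ExtVanishes I e M :=
  fun k i hi => h k i (hi.trans_le hed)

section ShortComplex

variable (X : ModuleCat.{v} R) {S : ShortComplex (ModuleCat.{v} R)}

theorem subsingleton_ext_X₂ (hS : S.ShortExact) (i : ℕ) (h₁ : Subsingleton (Abelian.Ext X S.X₁ i))
    (h₃ : Subsingleton (Abelian.Ext X S.X₃ i)) : Subsingleton (Abelian.Ext X S.X₂ i) := by
  have key : ∀ x : Abelian.Ext X S.X₂ i, x = 0 := by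
    intro x
    obtain ⟨y, rfl⟩ := Abelian.Ext.covariant_sequence_exact₂ _ hS x (Subsingleton.elim _ _)
    rw [Subsingleton.elim y 0, Abelian.Ext.zero_comp]
  exact ⟨fun a b => by rw [key a, key b]⟩

theorem postcomp_f_injective_zero (hS : S.ShortExact) (x : Abelian.Ext X S.X₁ 0)
    (hx : x.comp (Abelian.Ext.mk₀ S.f) (add_zero 0) = 0) : x = 0 := by
  have := hS.mono_f
  exact Abelian.Ext.postcomp_mk₀_injective_of_mono X S.f (hx.trans (map_zero _).symm)

theorem postcomp_f_injective_succ (hS : S.ShortExact) (i : ℕ)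
    (h₃ : Subsingleton (Abelian.Ext X S.X₃ i)) (x : Abelian.Ext X S.X₁ (i + 1))
    (hx : x.comp (Abelian.Ext.mk₀ S.f) (add_zero _) = 0) : x = 0 := by
  obtain ⟨y, rfl⟩ := Abelian.Ext.covariant_sequence_exact₁ _ hS x hx rfl
  rw [Subsingleton.elim y 0, Abelian.Ext.zero_comp]

/-- The kernel is the image of the Ext of the third term one degree lower. Quantifying over j with j
+ 1 = i makes degree 0 condition-free, where left exactness of Hom suffices. -/
theorem postcomp_f_injective (hS : S.ShortExact) (i : ℕ)
    (h₃ : ∀ j, j + 1 = i → Subsingleton (Abelian.Ext X S.X₃ j)) (x : Abelian.Ext X S.X₁ i)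
    (hx : x.comp (Abelian.Ext.mk₀ S.f) (add_zero _) = 0) : x = 0 := by
  obtain _ | i := i
  · exact postcomp_f_injective_zero X hS x hx
  · exact postcomp_f_injective_succ X hS i (h₃ i rfl) x hx

end ShortComplex

section ShortExact

variable {I : Ideal R} {A B C : Type v} [AddCommGroup A] [AddCommGroup B] [AddCommGroup C]
  [Module R A] [Module R B] [Module R C] (f : A →ₗ[R] B) (g : B →ₗ[R] C)

/-- The short complex of modules given by two composable linear maps. -/
def shortComplexOf (hfg : Function.Exact f g) : ShortComplex (ModuleCat.{v} R) :=
  ShortComplex.mk (ModuleCat.ofHom f) (ModuleCat.ofHom g)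
    (by ext x; exact hfg.apply_apply_eq_zero x)

theorem shortComplexOf_shortExact (hf : Function.Injective f) (hg : Function.Surjective g)
    (hfg : Function.Exact f g) : (shortComplexOf f g hfg).ShortExact where
  exact := by
    rw [ShortComplex.moduleCat_exact_iff]
    intro x hx
    exact (hfg x).1 hx
  mono_f := (ModuleCat.mono_iff_injective _).2 hf
  epi_g := (ModuleCat.epi_iff_surjective _).2 hg

theorem ExtVanishes.middle (hf : Function.Injective f) (hg : Function.Surjective g)
    (hfg : Function.Exact f g) {d : ℕ} (hA : ExtVanishes I d A) (hC : ExtVanishes I d C) :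
    ExtVanishes I d B := by
  intro k i hi
  exact subsingleton_ext_X₂ _ (shortComplexOf_shortExact f g hf hg hfg) i (hA k i hi) (hC k i hi)

theorem ExtVanishes.left (hf : Function.Injective f) (hg : Function.Surjective g)
    (hfg : Function.Exact f g) {d : ℕ} (hB : ExtVanishes I d B) (hC : ExtVanishes I (d - 1) C) :
    ExtVanishes I d A := by
  intro k i hi
  have hS := shortComplexOf_shortExact f g hf hg hfg
  have hBi : Subsingleton (Abelian.Ext (ModuleCat.of R (R ⧸ I ^ k)) (shortComplexOf f g hfg).X₂ i) :=
    hB k i hi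
  have key : ∀ x : Abelian.Ext (ModuleCat.of R (R ⧸ I ^ k)) (shortComplexOf f g hfg).X₁ i, x = 0 :=
    fun x => postcomp_f_injective _ hS i (fun j hj => hC k j (by omega)) x (Subsingleton.elim _ _)
  exact ⟨fun a b => (key a).trans (key b).symm⟩

/-- If `f` is multiplication by a regular element `r ∈ I`, then the vanishing range of the
cokernel is shorter by at most one. -/
theorem ExtVanishes.of_smul (f : A →ₗ[R] A) (g : A →ₗ[R] C) (r : R) (hr : r ∈ I)
    (hfr : ∀ a, f a = r • a) (hf : Function.Injective f) (hg : Function.Surjective g)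
    (hfg : Function.Exact f g) {d : ℕ} (hC : ExtVanishes I d C) :
    ExtVanishes I (d + 1) A := by
  intro k i hi
  have hS := shortComplexOf_shortExact f g hf hg hfg
  have hSf : (shortComplexOf f g hfg).f = r • 𝟙 (ModuleCat.of R A) := by
    ext a; exact hfr a
  let N := ModuleCat.of R (R ⧸ I ^ k)
  -- Up to degree d, the kernel of r on Ext comes from Ext^(i-1) of the cokernel, which vanishes.
  have hinj : ∀ x : Abelian.Ext N (ModuleCat.of R A) i, r • x = 0 → x = 0 := by
    intro x hx
    rw [Abelian.Ext.smul_eq_comp_mk₀] at hx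
    rw [← hSf] at hx
    exact postcomp_f_injective N hS i (fun j hj => hC k j (by omega)) x hx
  have hpow : ∀ (n : ℕ) (x : Abelian.Ext N (ModuleCat.of R A) i), r ^ n • x = 0 → x = 0 := by
    intro n
    induction n with
    | zero => intro x hx; simpa using hx
    | succ n ih =>
      intro x hx
      refine ih x (hinj _ ?_)
      rw [smul_smul, ← pow_succ']; exact hx
  -- Conversely r^k annihilates R/I^k, hence its Ext modules. An injective action that is nilpotent
  -- leaves only zero.
  have hzero : ∀ x : Abelian.Ext N (ModuleCat.of R A) i, r ^ k • x = 0 := by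
    intro x
    have h0 : r ^ k • 𝟙 N = 0 := by
      refine ModuleCat.hom_ext (LinearMap.ext fun a => ?_)
      obtain ⟨a, rfl⟩ := Ideal.Quotient.mk_surjective (I := I ^ k) a
      change r ^ k • Ideal.Quotient.mk (I ^ k) a = 0
      rw [← Ideal.Quotient.mk_eq_mk, ← Submodule.Quotient.mk_smul, Submodule.Quotient.mk_eq_zero]
      exact Ideal.mul_mem_right _ _ (Ideal.pow_mem_pow hr k)
    calc r ^ k • x = r ^ k • (Abelian.Ext.mk₀ (𝟙 N)).comp x (zero_add i) := by simp
      _ = (Abelian.Ext.mk₀ (r ^ k • 𝟙 N)).comp x (zero_add i) := by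
        rw [Abelian.Ext.mk₀_smul, Abelian.Ext.smul_comp]
      _ = 0 := by rw [h0]; simp
  exact ⟨fun a b => by rw [hpow k a (hzero a), hpow k b (hzero b)]⟩

end ShortExact

/-! ### Exact sequences of cyclic modules: regular elements, colon ideals, Mayer–Vietoris. -/

section Ideals

variable {I : Ideal R} {d : ℕ}

theorem mem_sup_span_singleton_iff_mem_range {J P : Ideal R} {r : R}
    (h : P ≤ Submodule.comap (r • (LinearMap.id : R →ₗ[R] R)) J) (a : R) :
    a ∈ J ⊔ Ideal.span {r} ↔
      (Submodule.Quotient.mk a : R ⧸ J) ∈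
        Set.range (Submodule.mapQ P J (r • (LinearMap.id : R →ₗ[R] R)) h) := by
  rw [sup_comm, Ideal.mem_span_singleton_sup]
  constructor
  · rintro ⟨b, c, hc, rfl⟩
    refine ⟨Submodule.Quotient.mk b, ?_⟩
    change Submodule.Quotient.mk (r * b) = _
    rw [Submodule.Quotient.eq]
    have : r * b - (b * r + c) = -c := by ring
    rw [this]
    exact J.neg_mem hc
  · rintro ⟨b, hb⟩
    obtain ⟨b, rfl⟩ := Submodule.Quotient.mk_surjective _ b
    refine ⟨b, a - b * r, ?_, by ring⟩
    rw [mul_comm b r]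
    exact (Submodule.Quotient.eq J).1 hb.symm

theorem ExtVanishes.quotient_of_regular {J : Ideal R} {r : R} (hr : r ∈ I)
    (hreg : ∀ a, r * a ∈ J → a ∈ J) (h : ExtVanishes I d (R ⧸ (J ⊔ Ideal.span {r}))) :
    ExtVanishes I (d + 1) (R ⧸ J) := by
  have hle : J ≤ Submodule.comap (r • (LinearMap.id : R →ₗ[R] R)) J :=
    fun a ha => J.mul_mem_left r ha
  refine ExtVanishes.of_smul (Submodule.mapQ J J _ hle) (Submodule.factor (le_sup_left : J ≤ J ⊔ Ideal.span {r})) r hr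
    ?_ ?_ (Submodule.factor_surjective _) ?_ h
  · intro a
    obtain ⟨a, rfl⟩ := Submodule.Quotient.mk_surjective _ a
    rfl
  · rw [← LinearMap.ker_eq_bot, LinearMap.ker_eq_bot']
    intro a ha
    obtain ⟨a, rfl⟩ := Submodule.Quotient.mk_surjective _ a
    exact (Submodule.Quotient.mk_eq_zero _).2 (hreg a ((Submodule.Quotient.mk_eq_zero _).1 ha))
  · intro a
    obtain ⟨a, rfl⟩ := Submodule.Quotient.mk_surjective _ a
    change Submodule.Quotient.mk a = 0 ↔ _
    rw [Submodule.Quotient.mk_eq_zero]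
    exact mem_sup_span_singleton_iff_mem_range hle a

/-- Multiplication by r yields 0 → R/(J : r) → R/J → R/(J + (r)) → 0, with P playing the role of J :
r. -/
theorem ExtVanishes.quotient_of_colon {J P : Ideal R} {r : R}
    (hcol : ∀ a, r * a ∈ J ↔ a ∈ P) (hP : ExtVanishes I d (R ⧸ P))
    (h : ExtVanishes I d (R ⧸ (J ⊔ Ideal.span {r}))) :
    ExtVanishes I d (R ⧸ J) := by
  have hle : P ≤ Submodule.comap (r • (LinearMap.id : R →ₗ[R] R)) J :=
    fun a ha => (hcol a).2 ha
  refine ExtVanishes.middle (Submodule.mapQ P J _ hle)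
    (Submodule.factor (le_sup_left : J ≤ J ⊔ Ideal.span {r})) ?_ (Submodule.factor_surjective _) ?_ hP h
  · rw [← LinearMap.ker_eq_bot, LinearMap.ker_eq_bot']
    intro a ha
    obtain ⟨a, rfl⟩ := Submodule.Quotient.mk_surjective _ a
    exact (Submodule.Quotient.mk_eq_zero _).2 ((hcol a).1 ((Submodule.Quotient.mk_eq_zero _).1 ha))
  · intro a
    obtain ⟨a, rfl⟩ := Submodule.Quotient.mk_surjective _ a
    change Submodule.Quotient.mk a = 0 ↔ _
    rw [Submodule.Quotient.mk_eq_zero]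
    exact mem_sup_span_singleton_iff_mem_range hle a

/-- Mayer–Vietoris, with the difference map onto R/(J₁ + J₂). The connecting map raises degree by
one, so the sum may be worse by one. -/
theorem ExtVanishes.quotient_inf {J₁ J₂ : Ideal R} (h₁ : ExtVanishes I d (R ⧸ J₁))
    (h₂ : ExtVanishes I d (R ⧸ J₂)) (h : ExtVanishes I (d - 1) (R ⧸ (J₁ ⊔ J₂))) :
    ExtVanishes I d (R ⧸ (J₁ ⊓ J₂)) := by
  have hprod : ExtVanishes I d ((R ⧸ J₁) × (R ⧸ J₂)) :=
    ExtVanishes.middle (LinearMap.inl R (R ⧸ J₁) (R ⧸ J₂)) (LinearMap.snd R _ _) LinearMap.inl_injective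
      LinearMap.snd_surjective Function.Exact.inl_snd h₁ h₂
  refine ExtVanishes.left
    ((Submodule.factor (inf_le_left : J₁ ⊓ J₂ ≤ J₁)).prod (Submodule.factor (inf_le_right : J₁ ⊓ J₂ ≤ J₂)))
    ((Submodule.factor (le_sup_left : J₁ ≤ J₁ ⊔ J₂)).coprod
      (-Submodule.factor (le_sup_right : J₂ ≤ J₁ ⊔ J₂))) ?_ ?_ ?_ hprod h
  · rw [← LinearMap.ker_eq_bot, LinearMap.ker_eq_bot']
    intro a ha
    obtain ⟨a, rfl⟩ := Submodule.Quotient.mk_surjective _ a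
    have h1 := congrArg Prod.fst ha
    have h2 := congrArg Prod.snd ha
    exact (Submodule.Quotient.mk_eq_zero _).2
      ⟨(Submodule.Quotient.mk_eq_zero _).1 h1, (Submodule.Quotient.mk_eq_zero _).1 h2⟩
  · intro c
    obtain ⟨a, rfl⟩ := Submodule.factor_surjective (le_sup_left : J₁ ≤ J₁ ⊔ J₂) c
    exact ⟨(a, 0), by simp⟩
  · rintro ⟨a, b⟩
    obtain ⟨a, rfl⟩ := Submodule.Quotient.mk_surjective _ a
    obtain ⟨b, rfl⟩ := Submodule.Quotient.mk_surjective _ b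
    constructor
    · intro hab
      have : a - b ∈ J₁ ⊔ J₂ := by
        rw [← Submodule.Quotient.mk_eq_zero, Submodule.Quotient.mk_sub, sub_eq_add_neg]
        exact hab
      obtain ⟨p, hp, q, hq, hpq⟩ := Submodule.mem_sup.1 this
      refine ⟨Submodule.Quotient.mk (a - p), Prod.ext ?_ ?_⟩
      · change Submodule.Quotient.mk (a - p) = Submodule.Quotient.mk a
        rw [Submodule.Quotient.eq]; simpa using hp
      · change Submodule.Quotient.mk (a - p) = Submodule.Quotient.mk b
        rw [Submodule.Quotient.eq]
        have : a - p - b = q := by linear_combination -hpq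
        rwa [this]
    · rintro ⟨c, hc⟩
      rw [← hc]
      obtain ⟨c, rfl⟩ := Submodule.Quotient.mk_surjective _ c
      change (Submodule.Quotient.mk c : R ⧸ (J₁ ⊔ J₂)) + -Submodule.Quotient.mk c = 0
      exact add_neg_cancel _

end Ideals

end Homological

/-! ### Binomial edge ideals inside a fixed ring, and Ohtani's decomposition. -/

section Minors

variable (K : Type w) [Field K] {V : Type u}

/-- The binomial `x_i y_j - x_j y_i`. -/
def minor (i j : V) : PolyRing K V := x K i * y K j - x K j * y K i

/-- The ideal `(x_v, y_v)`. -/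
def vertexIdeal (v : V) : Ideal (PolyRing K V) := Ideal.span {x K v, y K v}

/-- For a graph `G` on `W` and a map `f : W → V`, the ideal of `K[x_v, y_v : v ∈ V]` generated by
the variables of the vertices outside of the range of `f` and by the binomials of the edges of `G`.
If `f` is injective, the quotient by it is `K[x_w, y_w : w ∈ W] / J_G`. -/
def embeddedIdeal {W : Type*} (f : W → V) (G : SimpleGraph W) : Ideal (PolyRing K V) :=
  Ideal.span ({p | ∃ u ∉ Set.range f, p = x K u ∨ p = y K u} ∪
    {p | ∃ i j, G.Adj i j ∧ p = minor K (f i) (f j)})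

/-- The substitution `x_v, y_v ↦ 0`. -/
def killVertex [DecidableEq V] (v : V) : PolyRing K V →ₐ[K] PolyRing K V :=
  MvPolynomial.aeval (Sum.elim (fun u => if u = v then 0 else x K u)
    (fun u => if u = v then 0 else y K u))

variable {K}

theorem x_mem_vertexIdeal (v : V) : x K v ∈ vertexIdeal K v :=
  Ideal.subset_span (Or.inl rfl)

theorem y_mem_vertexIdeal (v : V) : y K v ∈ vertexIdeal K v :=
  Ideal.subset_span (Or.inr rfl)

theorem minor_mem_of_x_mem_of_y_mem {I : Ideal (PolyRing K V)} {v : V} (hx : x K v ∈ I)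
    (hy : y K v ∈ I) (j : V) : minor K v j ∈ I :=
  I.sub_mem (I.mul_mem_right _ hx) (I.mul_mem_left _ hy)

theorem minor_swap (i j : V) : minor K i j = -minor K j i := by
  simp only [minor]; ring

theorem minor_mem_swap {I : Ideal (PolyRing K V)} {i j : V} (h : minor K i j ∈ I) :
    minor K j i ∈ I := by
  rw [minor_swap]; exact I.neg_mem h

/-- The Plücker-type relation x_v [i j] = x_i [v j] - x_j [v i], and the same with y_v, y_i, y_j as
coefficients. It says that (x_v, y_v) multiplies the edges added in G_v back into J_G. -/
theorem mul_minor_mem {I : Ideal (PolyRing K V)} {v i j : V} (hi : minor K v i ∈ I)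
    (hj : minor K v j ∈ I) {a : PolyRing K V} (ha : a ∈ vertexIdeal K v) :
    a * minor K i j ∈ I := by
  refine Submodule.span_induction (p := fun a _ => a * minor K i j ∈ I) ?_ ?_ ?_ ?_ ha
  · rintro _ (rfl | rfl)
    · have : x K v * minor K i j = x K i * minor K v j - x K j * minor K v i := by
        simp only [minor]; ring
      rw [this]
      exact I.sub_mem (I.mul_mem_left _ hj) (I.mul_mem_left _ hi)
    · have : y K v * minor K i j = y K i * minor K v j - y K j * minor K v i := by
        simp only [minor]; ring
      rw [this]
      exact I.sub_mem (I.mul_mem_left _ hj) (I.mul_mem_left _ hi)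
  · simp
  · intro a b _ _ ha hb
    rw [add_mul]; exact I.add_mem ha hb
  · intro r a _ ha
    rw [smul_eq_mul, mul_assoc]; exact I.mul_mem_left _ ha

section Kill

variable [DecidableEq V] (v : V)

theorem killVertex_x (u : V) : killVertex K v (x K u) = if u = v then 0 else x K u := by
  simp [killVertex, x]

theorem killVertex_y (u : V) : killVertex K v (y K u) = if u = v then 0 else y K u := by
  simp [killVertex, y]

theorem killVertex_eq_zero {a : PolyRing K V} (ha : a ∈ vertexIdeal K v) :
    killVertex K v a = 0 := by
  have : vertexIdeal K v ≤ RingHom.ker (killVertex K v) := by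
    refine Ideal.span_le.2 ?_
    rintro _ (rfl | rfl)
    · simp [RingHom.mem_ker, killVertex_x]
    · simp [RingHom.mem_ker, killVertex_y]
  exact this ha

theorem sub_killVertex_mem (a : PolyRing K V) : a - killVertex K v a ∈ vertexIdeal K v := by
  induction a using MvPolynomial.induction_on with
  | C a => simp [killVertex]
  | add p q hp hq =>
    rw [map_add, add_sub_add_comm]; exact Ideal.add_mem _ hp hq
  | mul_X p s hp =>
    have hs : MvPolynomial.X s - killVertex K v (MvPolynomial.X s) ∈ vertexIdeal K v := by
      obtain u | u := s
      · change x K u - killVertex K v (x K u) ∈ _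
        rw [killVertex_x]
        split_ifs with h
        · subst h; simpa using x_mem_vertexIdeal u
        · simp
      · change y K u - killVertex K v (y K u) ∈ _
        rw [killVertex_y]
        split_ifs with h
        · subst h; simpa using y_mem_vertexIdeal u
        · simp
    have : p * MvPolynomial.X s - killVertex K v (p * MvPolynomial.X s) =
        (p - killVertex K v p) * MvPolynomial.X s +
          killVertex K v p * (MvPolynomial.X s - killVertex K v (MvPolynomial.X s)) := by
      rw [map_mul]; ring
    rw [this]
    exact Ideal.add_mem _ (Ideal.mul_mem_right _ _ hp) (Ideal.mul_mem_left _ _ hs)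

end Kill

section Embedded

variable {W : Type*} {f : W → V} {G : SimpleGraph W}

theorem x_mem_embeddedIdeal {u : V} (hu : u ∉ Set.range f) : x K u ∈ embeddedIdeal K f G :=
  Ideal.subset_span (Or.inl ⟨u, hu, Or.inl rfl⟩)

theorem y_mem_embeddedIdeal {u : V} (hu : u ∉ Set.range f) : y K u ∈ embeddedIdeal K f G :=
  Ideal.subset_span (Or.inl ⟨u, hu, Or.inr rfl⟩)

theorem minor_mem_embeddedIdeal {i j : W} (h : G.Adj i j) :
    minor K (f i) (f j) ∈ embeddedIdeal K f G :=
  Ideal.subset_span (Or.inr ⟨i, j, h, rfl⟩)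

theorem embeddedIdeal_le {I : Ideal (PolyRing K V)}
    (hx : ∀ u ∉ Set.range f, x K u ∈ I) (hy : ∀ u ∉ Set.range f, y K u ∈ I)
    (hm : ∀ i j, G.Adj i j → minor K (f i) (f j) ∈ I) : embeddedIdeal K f G ≤ I := by
  refine Ideal.span_le.2 ?_
  rintro _ (⟨u, hu, rfl | rfl⟩ | ⟨i, j, h, rfl⟩)
  exacts [hx u hu, hy u hu, hm i j h]

theorem embeddedIdeal_mono {G' : SimpleGraph W} (h : G ≤ G') :
    embeddedIdeal K f G ≤ embeddedIdeal K f G' :=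
  embeddedIdeal_le (fun _ => x_mem_embeddedIdeal) (fun _ => y_mem_embeddedIdeal)
    fun _ _ hij => minor_mem_embeddedIdeal (h hij)

theorem le_completeAt (v : W) : G ≤ completeAt G v := fun _ _ h => Or.inl h

variable (v : W)

theorem notMem_range_delete {u : V} (hu : u ∉ Set.range f) :
    u ∉ Set.range (f ∘ ((↑) : ({v}ᶜ : Set W) → W)) := by
  rintro ⟨w, rfl⟩; exact hu ⟨w, rfl⟩

theorem apply_notMem_range_delete (hf : Function.Injective f) :
    f v ∉ Set.range (f ∘ ((↑) : ({v}ᶜ : Set W) → W)) := by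
  rintro ⟨w, hw⟩; exact w.2 (hf hw)

theorem embeddedIdeal_le_delete (hf : Function.Injective f) :
    embeddedIdeal K f G ≤
      embeddedIdeal K (f ∘ ((↑) : ({v}ᶜ : Set W) → W)) (deleteVertex G v) := by
  have hvx := x_mem_embeddedIdeal (K := K) (G := deleteVertex G v) (apply_notMem_range_delete v hf)
  have hvy := y_mem_embeddedIdeal (K := K) (G := deleteVertex G v) (apply_notMem_range_delete v hf)
  refine embeddedIdeal_le (fun u hu => x_mem_embeddedIdeal (notMem_range_delete v hu))
    (fun u hu => y_mem_embeddedIdeal (notMem_range_delete v hu)) fun i j hij => ?_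
  by_cases hi : i = v
  · subst hi; exact minor_mem_of_x_mem_of_y_mem hvx hvy _
  by_cases hj : j = v
  · subst hj; exact minor_mem_swap (minor_mem_of_x_mem_of_y_mem hvx hvy _)
  exact minor_mem_embeddedIdeal (G := deleteVertex G v) (i := ⟨i, hi⟩) (j := ⟨j, hj⟩) hij

theorem delete_le_sup :
    embeddedIdeal K (f ∘ ((↑) : ({v}ᶜ : Set W) → W)) (deleteVertex G v) ≤
      vertexIdeal K (f v) ⊔ embeddedIdeal K f G := by
  have hcase : ∀ u ∉ Set.range (f ∘ ((↑) : ({v}ᶜ : Set W) → W)), u = f v ∨ u ∉ Set.range f := by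
    intro u hu
    by_contra! h
    obtain ⟨w, rfl⟩ := h.2
    exact hu ⟨⟨w, fun hw => h.1 (congrArg f hw)⟩, rfl⟩
  refine embeddedIdeal_le (fun u hu => ?_) (fun u hu => ?_) fun i j hij => ?_
  · obtain rfl | h := hcase u hu
    · exact Ideal.mem_sup_left (x_mem_vertexIdeal _)
    · exact Ideal.mem_sup_right (x_mem_embeddedIdeal h)
  · obtain rfl | h := hcase u hu
    · exact Ideal.mem_sup_left (y_mem_vertexIdeal _)
    · exact Ideal.mem_sup_right (y_mem_embeddedIdeal h)
  · exact Ideal.mem_sup_right (minor_mem_embeddedIdeal (f := f) (G := G) hij)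

/-- Let π set x_v and y_v to zero. Generators at v come from edges of G and die under π. The others
are fixed by π, so ap - π(ap) = (a - π(a))p with a - π(a) in (x_v, y_v), and `mul_minor_mem` handles
the added edges. -/
theorem sub_killVertex_mem_embeddedIdeal [DecidableEq V] (hf : Function.Injective f)
    {p : PolyRing K V} (hp : p ∈ embeddedIdeal K f (completeAt G v)) :
    p - killVertex K (f v) p ∈ embeddedIdeal K f G := by
  set B := embeddedIdeal K f G
  -- The condition on p alone is not visibly stable under multiplication, so the span induction
  -- carries all multiples of p.
  suffices h : ∀ a, a * p - killVertex K (f v) (a * p) ∈ B by simpa using h 1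
  refine Submodule.span_induction
    (p := fun p _ => ∀ a, a * p - killVertex K (f v) (a * p) ∈ B) ?_ ?_ ?_ ?_ hp
  · have key₁ : ∀ p ∈ B, killVertex K (f v) p = 0 →
        ∀ a, a * p - killVertex K (f v) (a * p) ∈ B := by
      intro p hpB hp a
      rw [map_mul, hp, mul_zero, sub_zero]
      exact B.mul_mem_left _ hpB
    have key₂ : ∀ p, killVertex K (f v) p = p → (∀ b ∈ vertexIdeal K (f v), b * p ∈ B) →
        ∀ a, a * p - killVertex K (f v) (a * p) ∈ B := by
      intro p hp h a
      rw [map_mul, hp, ← sub_mul]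
      exact h _ (sub_killVertex_mem _ _)
    rintro p (⟨u, hu, rfl | rfl⟩ | ⟨i, j, hij, rfl⟩)
    · refine key₂ _ ?_ fun b _ => B.mul_mem_left _ (x_mem_embeddedIdeal hu)
      rw [killVertex_x, if_neg]
      rintro rfl; exact hu ⟨v, rfl⟩
    · refine key₂ _ ?_ fun b _ => B.mul_mem_left _ (y_mem_embeddedIdeal hu)
      rw [killVertex_y, if_neg]
      rintro rfl; exact hu ⟨v, rfl⟩
    · by_cases hi : i = v
      · subst hi
        refine key₁ _ ?_ (by simp [minor, killVertex_x, killVertex_y])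
        rcases hij with hij | ⟨_, h, _⟩
        · exact minor_mem_embeddedIdeal hij
        · exact absurd h (G.irrefl)
      by_cases hj : j = v
      · subst hj
        refine key₁ _ ?_ (by simp [minor, killVertex_x, killVertex_y])
        rcases hij with hij | ⟨_, _, h⟩
        · exact minor_mem_embeddedIdeal hij
        · exact absurd h (G.irrefl)
      refine key₂ _ (by simp [minor, killVertex_x, killVertex_y, hf.eq_iff, hi, hj]) fun b hb => ?_
      rcases hij with hij | ⟨_, h₁, h₂⟩
      · exact B.mul_mem_left _ (minor_mem_embeddedIdeal hij)
      · exact mul_minor_mem (minor_mem_embeddedIdeal h₁) (minor_mem_embeddedIdeal h₂) hb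
  · simp
  · intro p q _ _ hp hq a
    rw [mul_add, map_add, add_sub_add_comm]
    exact B.add_mem (hp a) (hq a)
  · intro r p _ hp a
    rw [smul_eq_mul, ← mul_assoc]
    exact hp _

/-- Ohtani's decomposition `J_G = J_{G_v} ∩ ((x_v, y_v) + J_{G - v})`. -/
theorem embeddedIdeal_completeAt_inf_delete (hf : Function.Injective f) :
    embeddedIdeal K f (completeAt G v) ⊓
      embeddedIdeal K (f ∘ ((↑) : ({v}ᶜ : Set W) → W)) (deleteVertex G v) =
      embeddedIdeal K f G := by
  classical
  refine le_antisymm ?_ (le_inf (embeddedIdeal_mono (le_completeAt v))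
    (embeddedIdeal_le_delete v hf))
  rintro h ⟨h₁, h₂⟩
  -- Since q lies in J_G, p lies in both (x_v, y_v) and J_{G_v}. Then π(p) = 0, and p = p - π(p)
  -- lies in J_G.
  obtain ⟨p, hp, q, hq, rfl⟩ := Submodule.mem_sup.1 (delete_le_sup v h₂)
  have hpA : p ∈ embeddedIdeal K f (completeAt G v) :=
    (Submodule.add_mem_iff_left _ (embeddedIdeal_mono (le_completeAt v) hq)).1 h₁
  have := sub_killVertex_mem_embeddedIdeal v hf hpA
  rw [killVertex_eq_zero _ hp, sub_zero] at this
  exact Ideal.add_mem _ this hq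

theorem embeddedIdeal_completeAt_sup_delete (hf : Function.Injective f) :
    embeddedIdeal K f (completeAt G v) ⊔
      embeddedIdeal K (f ∘ ((↑) : ({v}ᶜ : Set W) → W)) (deleteVertex G v) =
      embeddedIdeal K (f ∘ ((↑) : ({v}ᶜ : Set W) → W)) (deleteVertex (completeAt G v) v) := by
  refine le_antisymm (sup_le (embeddedIdeal_le_delete v hf)
    (embeddedIdeal_mono fun i j h => le_completeAt v h)) ?_
  refine (delete_le_sup v).trans (sup_le ?_ le_sup_left)
  refine le_sup_of_le_right (Ideal.span_le.2 ?_)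
  rintro _ (rfl | rfl)
  · exact x_mem_embeddedIdeal (apply_notMem_range_delete v hf)
  · exact y_mem_embeddedIdeal (apply_notMem_range_delete v hf)

end Embedded

end Minors

/-! ### Toric parametrization and primality of the coloured ideals. -/

section Toric

variable (K : Type w) [Field K] {V : Type u} {ι : Type*} (c : V → ι) (D : Set V) (E : Set ι)

/-- For a colouring `c` of the vertices, the ideal generated by all binomials `x_i y_j - x_j y_i`
with `i` and `j` of the same colour, the variables `x_j, y_j` with `j ∈ D` and the variables `x_j`
with the colour of `j` in `E`. -/
def colouredIdeal : Ideal (PolyRing K V) :=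
  Ideal.span ({p | ∃ j ∈ D, p = x K j ∨ p = y K j} ∪ {p | ∃ j, c j ∈ E ∧ p = x K j} ∪
    {p | ∃ i j, c i = c j ∧ p = minor K i j})

open Classical in
/-- The parametrization `x_j ↦ a_{c j} t_j`, `y_j ↦ t_j`, with the variables in the ideal
`colouredIdeal K c D E` sent to zero. -/
def colouredParam : PolyRing K V →ₐ[K] MvPolynomial (ι ⊕ V) K :=
  MvPolynomial.aeval (Sum.elim
    (fun j => if j ∈ D ∨ c j ∈ E then 0 else
      MvPolynomial.X (Sum.inl (c j)) * MvPolynomial.X (Sum.inr j))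
    (fun j => if j ∈ D then 0 else MvPolynomial.X (Sum.inr j)))

variable {K c D E}

theorem x_mem_colouredIdeal {j : V} (hj : j ∈ D) : x K j ∈ colouredIdeal K c D E :=
  Ideal.subset_span (Or.inl (Or.inl ⟨j, hj, Or.inl rfl⟩))

theorem y_mem_colouredIdeal {j : V} (hj : j ∈ D) : y K j ∈ colouredIdeal K c D E :=
  Ideal.subset_span (Or.inl (Or.inl ⟨j, hj, Or.inr rfl⟩))

theorem x_mem_colouredIdeal' {j : V} (hj : c j ∈ E) : x K j ∈ colouredIdeal K c D E :=
  Ideal.subset_span (Or.inl (Or.inr ⟨j, hj, rfl⟩))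

theorem minor_mem_colouredIdeal {i j : V} (h : c i = c j) :
    minor K i j ∈ colouredIdeal K c D E :=
  Ideal.subset_span (Or.inr ⟨i, j, h, rfl⟩)

theorem colouredIdeal_le {I : Ideal (PolyRing K V)} (hx : ∀ j ∈ D, x K j ∈ I)
    (hy : ∀ j ∈ D, y K j ∈ I) (hE : ∀ j, c j ∈ E → x K j ∈ I)
    (hm : ∀ i j, c i = c j → minor K i j ∈ I) : colouredIdeal K c D E ≤ I := by
  refine Ideal.span_le.2 ?_
  rintro _ ((⟨j, hj, rfl | rfl⟩ | ⟨j, hj, rfl⟩) | ⟨i, j, h, rfl⟩)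
  exacts [hx j hj, hy j hj, hE j hj, hm i j h]

open Classical in
theorem colouredParam_x (j : V) : colouredParam K c D E (x K j) = if j ∈ D ∨ c j ∈ E then 0 else
      MvPolynomial.X (Sum.inl (c j)) * MvPolynomial.X (Sum.inr j) := by
  simp [colouredParam, x]

open Classical in
theorem colouredParam_y (j : V) : colouredParam K c D E (y K j) = if j ∈ D then 0 else
      MvPolynomial.X (Sum.inr j) := by
  simp [colouredParam, y]

theorem colouredParam_eq_zero {p : PolyRing K V} (hp : p ∈ colouredIdeal K c D E) :
    colouredParam K c D E p = 0 := by
  have : colouredIdeal K c D E ≤ RingHom.ker (colouredParam K c D E) := by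
    refine colouredIdeal_le (fun j hj => ?_) (fun j hj => ?_) (fun j hj => ?_) fun i j h => ?_
    · simp [RingHom.mem_ker, colouredParam_x, hj]
    · simp [RingHom.mem_ker, colouredParam_y, hj]
    · simp [RingHom.mem_ker, colouredParam_x, hj]
    · rw [RingHom.mem_ker, minor, map_sub, map_mul, map_mul]
      simp only [colouredParam_x, colouredParam_y]
      by_cases hi : i ∈ D
      · simp [hi]
      by_cases hj : j ∈ D
      · simp [hj]
      by_cases hE : c j ∈ E
      · simp [hE, h]
      · simp only [hi, hj, hE, h, or_self, if_false]
        ring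
  exact this hp

/-- The exponent of the image of a variable under the parametrization `x_j ↦ a_{c j} t_j`,
`y_j ↦ t_j`. -/
def paramExponent (c : V → ι) : V ⊕ V → ι ⊕ V →₀ ℕ :=
  Sum.elim (fun j => Finsupp.single (Sum.inl (c j)) 1 + Finsupp.single (Sum.inr j) 1)
    (fun j => Finsupp.single (Sum.inr j) 1)

/-- The exponent of the image of a monomial under the parametrization. -/
def paramDegree (c : V → ι) (m : V ⊕ V →₀ ℕ) : ι ⊕ V →₀ ℕ :=
  m.sum fun s k => k • paramExponent c s

open Classical in
theorem paramDegree_inr (m : V ⊕ V →₀ ℕ) (j : V) :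
    paramDegree c m (Sum.inr j) = m (Sum.inl j) + m (Sum.inr j) := by
  induction m using Finsupp.induction_linear with
  | zero => simp [paramDegree]
  | add p q hp hq =>
    rw [paramDegree, Finsupp.sum_add_index' (by simp) (by simp [add_smul]), Finsupp.add_apply]
    change paramDegree c p _ + paramDegree c q _ = _
    rw [hp, hq]; simp only [Finsupp.add_apply]; ring
  | single s k =>
    rw [paramDegree, Finsupp.sum_single_index (by simp)]
    obtain s | s := s <;> simp [paramExponent, Finsupp.single_apply]

open Classical in
theorem paramDegree_inl [Fintype V] (m : V ⊕ V →₀ ℕ) (k : ι) :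
    paramDegree c m (Sum.inl k) = ∑ j with c j = k, m (Sum.inl j) := by
  induction m using Finsupp.induction_linear with
  | zero => simp [paramDegree]
  | add p q hp hq =>
    rw [paramDegree, Finsupp.sum_add_index' (by simp) (by simp [add_smul]), Finsupp.add_apply]
    change paramDegree c p _ + paramDegree c q _ = _
    rw [hp, hq]; simp only [Finsupp.add_apply, Finset.sum_add_distrib]
  | single s l =>
    rw [paramDegree, Finsupp.sum_single_index (by simp)]
    obtain s | s := s <;> simp [paramExponent, Finsupp.single_apply]

open Classical in
-- Two monomials in one fibre of the parametrization are joined by exchanges x_i y_j → x_j y_i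
-- within a colour, each changing the monomial by a multiple of a minor. The truncated differences
-- in the induction measure the excess of x-exponents of m over m'.
theorem monomial_sub_monomial_mem [Fintype V] {I : Ideal (PolyRing K V)}
    (hI : ∀ i j, c i = c j → minor K i j ∈ I) (m m' : V ⊕ V →₀ ℕ)
    (h₁ : ∀ j, m (Sum.inl j) + m (Sum.inr j) = m' (Sum.inl j) + m' (Sum.inr j))
    (h₂ : ∀ k, ∑ j with c j = k, m (Sum.inl j) = ∑ j with c j = k, m' (Sum.inl j)) :
    (MvPolynomial.monomial m 1 - MvPolynomial.monomial m' 1 : PolyRing K V) ∈ I := by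
  induction hn : ∑ j, (m (Sum.inl j) - m' (Sum.inl j)) using Nat.strong_induction_on
    generalizing m with
  | _ n ih =>
  by_cases hle : ∀ j, m (Sum.inl j) ≤ m' (Sum.inl j)
  · have heq : ∀ j, m (Sum.inl j) = m' (Sum.inl j) := by
      intro j
      exact (Finset.sum_eq_sum_iff_of_le (fun i _ => hle i)).1 (h₂ (c j)) j (by simp)
    have : m = m' := by
      ext (j | j)
      · exact heq j
      · have := h₁ j; have := heq j; omega
    simp [this]
  · push Not at hle
    obtain ⟨i, hi⟩ := hle
    -- Excess at i must be balanced by a deficit at some j of the same colour; equal total degree at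
    -- j then forces y_j to divide m.
    obtain ⟨j, hj, hji⟩ : ∃ j, c j = c i ∧ m (Sum.inl j) < m' (Sum.inl j) := by
      by_contra! hcon
      refine absurd (h₂ (c i)) (ne_of_gt ?_)
      exact Finset.sum_lt_sum (fun j hj => hcon j (by simpa using hj)) ⟨i, by simp, hi⟩
    have hij : i ≠ j := by rintro rfl; omega
    have hjr : 0 < m (Sum.inr j) := by have := h₁ j; omega
    obtain ⟨r, rfl⟩ : ∃ r, m = Finsupp.single (Sum.inl i) 1 + Finsupp.single (Sum.inr j) 1 + r := by
      refine ⟨m - (Finsupp.single (Sum.inl i) 1 + Finsupp.single (Sum.inr j) 1), ?_⟩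
      rw [add_tsub_cancel_of_le]
      rintro (s | s)
      · by_cases hs : i = s
        · subst hs; simp; omega
        · simp [hs]
      · by_cases hs : j = s
        · subst hs; simp; omega
        · simp [hs]
    set m'' := Finsupp.single (Sum.inl j) 1 + Finsupp.single (Sum.inr i) 1 + r with hm''
    have hmove : (MvPolynomial.monomial
        (Finsupp.single (Sum.inl i) 1 + Finsupp.single (Sum.inr j) 1 + r) 1 -
        MvPolynomial.monomial m'' 1 : PolyRing K V) =
        MvPolynomial.monomial r 1 * minor K i j := by
      simp only [hm'', minor, x, y, MvPolynomial.X, MvPolynomial.monomial_mul, mul_sub, mul_one]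
      congr 2 <;> rw [add_comm r]
    have hmem := ih (∑ a, (m'' (Sum.inl a) - m' (Sum.inl a))) ?_ m'' ?_ ?_ rfl
    · rw [← sub_add_sub_cancel _ (MvPolynomial.monomial m'' 1), hmove]
      exact I.add_mem (I.mul_mem_left _ (hI i j hj.symm)) hmem
    · rw [← hn]
      refine Finset.sum_lt_sum (fun a _ => ?_) ⟨i, Finset.mem_univ _, ?_⟩
      · by_cases ha : j = a
        · subst ha
          simp [hm'', hij] at hji ⊢
          omega
        · simp [hm'', Finsupp.single_apply, ha]
          omega
      · simp [hm'', hij.symm] at hi ⊢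
        omega
    · intro a
      rw [← h₁ a]
      simp only [hm'', Finsupp.add_apply, Finsupp.single_apply, Sum.inl.injEq, Sum.inr.injEq,
        reduceCtorEq, if_false]
      omega
    · intro k
      rw [← h₂ k]
      simp [hm'', Finset.sum_add_distrib, Finsupp.single_apply, Finset.sum_ite_eq, hj]

open Classical in
-- Each variable is either killed and in the ideal, or sent to a monomial; both alternatives pass to
-- products.
theorem colouredParam_monomial (m : V ⊕ V →₀ ℕ) :
    (colouredParam K c D E (MvPolynomial.monomial m 1) = 0 ∧
      (MvPolynomial.monomial m 1 : PolyRing K V) ∈ colouredIdeal K c D E) ∨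
    colouredParam K c D E (MvPolynomial.monomial m 1) =
      MvPolynomial.monomial (paramDegree c m) 1 := by
  induction m using Finsupp.induction_linear with
  | zero => right; simp [paramDegree]
  | add p q hp hq =>
    have hpq : (MvPolynomial.monomial (p + q) 1 : PolyRing K V) =
        MvPolynomial.monomial p 1 * MvPolynomial.monomial q 1 := by
      rw [MvPolynomial.monomial_mul, one_mul]
    rw [hpq, map_mul]
    rcases hp with ⟨hp, hp'⟩ | hp
    · left; rw [hp, zero_mul]; exact ⟨rfl, Ideal.mul_mem_right _ _ hp'⟩
    rcases hq with ⟨hq, hq'⟩ | hq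
    · left; rw [hq, mul_zero]; exact ⟨rfl, Ideal.mul_mem_left _ _ hq'⟩
    right
    rw [hp, hq, MvPolynomial.monomial_mul, one_mul, paramDegree, paramDegree, paramDegree,
      Finsupp.sum_add_index' (by simp) (by simp [add_smul])]
  | single s k =>
    obtain _ | k := k
    · right; simp [paramDegree]
    have hs : (MvPolynomial.monomial (Finsupp.single s (k + 1)) 1 : PolyRing K V) =
        MvPolynomial.X s ^ (k + 1) := by rw [MvPolynomial.X_pow_eq_monomial]
    have hcase : (colouredParam K c D E (MvPolynomial.X s) = 0 ∧
          MvPolynomial.X s ∈ colouredIdeal K c D E) ∨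
        colouredParam K c D E (MvPolynomial.X s) =
          MvPolynomial.monomial (paramExponent c s) 1 := by
      obtain j | j := s
      · by_cases hj : j ∈ D ∨ c j ∈ E
        · left
          refine ⟨(colouredParam_x j).trans (if_pos hj), ?_⟩
          exact hj.elim x_mem_colouredIdeal x_mem_colouredIdeal'
        · right
          refine ((colouredParam_x j).trans (if_neg hj)).trans ?_
          simp [paramExponent, MvPolynomial.X, MvPolynomial.monomial_mul]
      · by_cases hj : j ∈ D
        · left
          exact ⟨(colouredParam_y j).trans (if_pos hj), y_mem_colouredIdeal hj⟩
        · right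
          refine ((colouredParam_y j).trans (if_neg hj)).trans ?_
          simp [paramExponent, MvPolynomial.X]
    rw [hs, map_pow]
    rcases hcase with ⟨h, h'⟩ | h
    · left
      rw [h]
      exact ⟨zero_pow k.succ_ne_zero, Ideal.pow_mem_of_mem _ h' _ k.succ_pos⟩
    · right
      rw [h, MvPolynomial.monomial_pow, one_pow, paramDegree, Finsupp.sum_single_index (by simp)]

open Classical in
/-- The kernel of the parametrization is the ideal `colouredIdeal K c D E`. -/
theorem mem_colouredIdeal_of_colouredParam_eq_zero [Finite V] {p : PolyRing K V}
    (hp : colouredParam K c D E p = 0) : p ∈ colouredIdeal K c D E := by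
  have := Fintype.ofFinite V
  set I := colouredIdeal K c D E with hI
  let mon : (V ⊕ V →₀ ℕ) → PolyRing K V := fun m => MvPolynomial.monomial m 1
  -- A linear map on the target sending a monomial to the class of a chosen monomial preimage.
  -- Independence of the choice modulo I makes its composite with the parametrization the quotient
  -- map, so the kernel lies in I. The value 0 off the image is irrelevant.
  let sec : MvPolynomial (ι ⊕ V) K →ₗ[K] PolyRing K V ⧸ I :=
    (MvPolynomial.basisMonomials (ι ⊕ V) K).constr K fun d =>
      if h : ∃ m, colouredParam K c D E (mon m) = MvPolynomial.monomial d 1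
      then Ideal.Quotient.mk I (mon h.choose) else 0
  have hsec : sec ∘ₗ (colouredParam K c D E).toLinearMap =
      (Ideal.Quotient.mkₐ K I).toLinearMap := by
    refine (MvPolynomial.basisMonomials (V ⊕ V) K).ext fun m => ?_
    simp only [MvPolynomial.coe_basisMonomials, LinearMap.comp_apply, AlgHom.toLinearMap_apply,
      Ideal.Quotient.mkₐ_eq_mk]
    rcases colouredParam_monomial (K := K) (c := c) (D := D) (E := E) m with ⟨h, h'⟩ | h
    · rw [h, map_zero, eq_comm, Ideal.Quotient.eq_zero_iff_mem]
      exact h'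
    · have hex : ∃ m', colouredParam K c D E (mon m') =
          MvPolynomial.monomial (paramDegree c m) 1 := ⟨m, h⟩
      have h1 : sec (MvPolynomial.monomial (paramDegree c m) 1) =
          Ideal.Quotient.mk I (mon hex.choose) := by
        have := (MvPolynomial.basisMonomials (ι ⊕ V) K).constr_basis K (fun d =>
          if h : ∃ m, colouredParam K c D E (mon m) = MvPolynomial.monomial d 1
          then Ideal.Quotient.mk I (mon h.choose) else 0) (paramDegree c m)
        rw [dif_pos hex] at this
        simpa [sec] using this
      rw [h, h1, Ideal.Quotient.eq]
      have hdeg : paramDegree c hex.choose = paramDegree c m := by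
        have hspec := hex.choose_spec
        rcases colouredParam_monomial (K := K) (c := c) (D := D) (E := E) hex.choose
          with ⟨h2, -⟩ | h2
        · rw [h2] at hspec
          exact absurd hspec.symm (by simp)
        · exact MvPolynomial.monomial_left_injective one_ne_zero (h2.symm.trans hspec)
      refine monomial_sub_monomial_mem (c := c) (fun i j hij => minor_mem_colouredIdeal hij) _ _
        (fun j => ?_) fun k => ?_
      · rw [← paramDegree_inr (c := c), ← paramDegree_inr (c := c), hdeg]
      · rw [← paramDegree_inl, ← paramDegree_inl, hdeg]
  have := LinearMap.congr_fun hsec p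
  rw [LinearMap.comp_apply, AlgHom.toLinearMap_apply, hp, map_zero] at this
  exact Ideal.Quotient.eq_zero_iff_mem.1 this.symm

/-- The ideal is the kernel of a map to a domain, hence prime. -/
theorem mem_colouredIdeal_of_mul_mem [Finite V] {p q : PolyRing K V}
    (hq : colouredParam K c D E q ≠ 0) (h : q * p ∈ colouredIdeal K c D E) :
    p ∈ colouredIdeal K c D E := by
  apply mem_colouredIdeal_of_colouredParam_eq_zero
  have := colouredParam_eq_zero h
  rw [map_mul] at this
  exact (mul_eq_zero.1 this).resolve_left hq

theorem mem_of_x_mul_mem [Finite V] {p : PolyRing K V} {j : V} (hj : j ∉ D) (hE : c j ∉ E)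
    (h : x K j * p ∈ colouredIdeal K c D E) : p ∈ colouredIdeal K c D E :=
  mem_colouredIdeal_of_mul_mem (by simp [colouredParam_x, hj, hE]) h

theorem mem_of_y_mul_mem [Finite V] {p : PolyRing K V} {j : V} (hj : j ∉ D)
    (h : y K j * p ∈ colouredIdeal K c D E) : p ∈ colouredIdeal K c D E :=
  mem_colouredIdeal_of_mul_mem (by simp [colouredParam_y, hj]) h

end Toric

/-! ### Depth of the coloured quotients. -/

section ColouredDepth

variable {K : Type w} [Field K] {V : Type u} {ι : Type*} {c : V → ι} {D : Set V} {E : Set ι}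

theorem colouredIdeal_le_insert_vertex (v : V) :
    colouredIdeal K c D E ≤ colouredIdeal K c (insert v D) E :=
  colouredIdeal_le (fun _ hj => x_mem_colouredIdeal (Or.inr hj))
    (fun _ hj => y_mem_colouredIdeal (Or.inr hj)) (fun _ hj => x_mem_colouredIdeal' hj)
    fun _ _ h => minor_mem_colouredIdeal h

theorem colouredIdeal_le_insert_colour (k : ι) :
    colouredIdeal K c D E ≤ colouredIdeal K c D (insert k E) :=
  colouredIdeal_le (fun _ hj => x_mem_colouredIdeal hj)
    (fun _ hj => y_mem_colouredIdeal hj) (fun _ hj => x_mem_colouredIdeal' (Or.inr hj))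
    fun _ _ h => minor_mem_colouredIdeal h

theorem colouredIdeal_insert_vertex_le {v : V} {I : Ideal (PolyRing K V)}
    (hI : colouredIdeal K c D E ≤ I) (hx : x K v ∈ I) (hy : y K v ∈ I) :
    colouredIdeal K c (insert v D) E ≤ I := by
  refine colouredIdeal_le ?_ ?_ (fun j hj => hI (x_mem_colouredIdeal' hj))
    fun i j h => hI (minor_mem_colouredIdeal h)
  · rintro j (rfl | hj)
    · exact hx
    · exact hI (x_mem_colouredIdeal hj)
  · rintro j (rfl | hj)
    · exact hy
    · exact hI (y_mem_colouredIdeal hj)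

theorem span_singleton_le_of_mem {R : Type*} [CommRing R] {I : Ideal R} {r : R} (h : r ∈ I) :
    Ideal.span {r} ≤ I :=
  (Ideal.span_singleton_le_iff_mem I).2 h

theorem colouredIdeal_sup_y {v : V} (hE : c v ∈ E) :
    colouredIdeal K c D E ⊔ Ideal.span {y K v} = colouredIdeal K c (insert v D) E :=
  le_antisymm
    (sup_le (colouredIdeal_le_insert_vertex v)
      (span_singleton_le_of_mem (y_mem_colouredIdeal (Or.inl rfl))))
    (colouredIdeal_insert_vertex_le le_sup_left
      (Ideal.mem_sup_left (x_mem_colouredIdeal' hE))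
      (Ideal.mem_sup_right (Ideal.mem_span_singleton_self _)))

theorem colouredIdeal_sup_x_sup_y (v : V) :
    colouredIdeal K c D E ⊔ Ideal.span {x K v} ⊔ Ideal.span {y K v} =
      colouredIdeal K c (insert v D) E :=
  le_antisymm
    (sup_le (sup_le (colouredIdeal_le_insert_vertex v)
      (span_singleton_le_of_mem (x_mem_colouredIdeal (Or.inl rfl))))
      (span_singleton_le_of_mem (y_mem_colouredIdeal (Or.inl rfl))))
    (colouredIdeal_insert_vertex_le (le_sup_left.trans le_sup_left)
      (Ideal.mem_sup_left (Ideal.mem_sup_right (Ideal.mem_span_singleton_self _)))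
      (Ideal.mem_sup_right (Ideal.mem_span_singleton_self _)))

theorem colouredIdeal_sup_x_le_insert_colour (v : V) :
    colouredIdeal K c D E ⊔ Ideal.span {x K v} ≤ colouredIdeal K c D (insert (c v) E) :=
  sup_le (colouredIdeal_le_insert_colour _)
    (span_singleton_le_of_mem (x_mem_colouredIdeal' (Or.inl rfl)))

theorem colouredIdeal_sup_x_of_unique {v : V} (hv : ∀ w ∉ D, c w = c v → w = v) :
    colouredIdeal K c D E ⊔ Ideal.span {x K v} = colouredIdeal K c D (insert (c v) E) := by
  refine le_antisymm (colouredIdeal_sup_x_le_insert_colour v) (colouredIdeal_le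
    (fun j hj => Ideal.mem_sup_left (x_mem_colouredIdeal hj))
    (fun j hj => Ideal.mem_sup_left (y_mem_colouredIdeal hj)) ?_
    fun i j h => Ideal.mem_sup_left (minor_mem_colouredIdeal h))
  rintro j (hj | hj)
  · by_cases hjD : j ∈ D
    · exact Ideal.mem_sup_left (x_mem_colouredIdeal hjD)
    · rw [hv j hjD hj]
      exact Ideal.mem_sup_right (Ideal.mem_span_singleton_self _)
  · exact Ideal.mem_sup_left (x_mem_colouredIdeal' hj)

/-- The ideal `colouredIdeal K c D E + (x_v)` has the colon ideal by `y_v` obtained by adding all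
`x_j` with `j` of the colour of `v`. -/
theorem y_mul_mem_colouredIdeal_sup_x_iff [Finite V] {v : V} (hv : v ∉ D) (a : PolyRing K V) :
    y K v * a ∈ colouredIdeal K c D E ⊔ Ideal.span {x K v} ↔
      a ∈ colouredIdeal K c D (insert (c v) E) := by
  set I := colouredIdeal K c D E ⊔ Ideal.span {x K v}
  have hI : colouredIdeal K c D E ≤ I := le_sup_left
  constructor
  -- The larger ideal is prime and, as v is outside D, does not contain y_v.
  · exact fun h => mem_of_y_mul_mem hv (colouredIdeal_sup_x_le_insert_colour v h)
  · intro h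
    have hle : colouredIdeal K c D (insert (c v) E) ≤ Submodule.comap (LinearMap.mulLeft _ (y K v)) I := by
      refine colouredIdeal_le
        (fun j hj => I.mul_mem_left _ (hI (x_mem_colouredIdeal hj)))
        (fun j hj => I.mul_mem_left _ (hI (y_mem_colouredIdeal hj))) ?_
        fun i j h => I.mul_mem_left _ (hI (minor_mem_colouredIdeal h))
      rintro j (hj | hj)
      · have : y K v * x K j = y K j * x K v - minor K v j := by simp only [minor]; ring
        change y K v * x K j ∈ I
        rw [this]
        exact I.sub_mem (I.mul_mem_left _ (Ideal.mem_sup_right (Ideal.mem_span_singleton_self _)))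
          (hI (minor_mem_colouredIdeal hj.symm))
      · exact I.mul_mem_left _ (hI (x_mem_colouredIdeal' hj))
    exact hle h

theorem x_mem_maximalHomogeneousIdeal (v : V) : x K v ∈ maximalHomogeneousIdeal K V :=
  Ideal.subset_span ⟨_, rfl⟩

theorem y_mem_maximalHomogeneousIdeal (v : V) : y K v ∈ maximalHomogeneousIdeal K V :=
  Ideal.subset_span ⟨_, rfl⟩

/-- The quotient by `colouredIdeal K c D E` has depth at least the number of vertices outside `D`
plus the number of their colours outside `E`. -/
theorem extVanishes_colouredIdeal [Finite V] (n : ℕ) (D : Set V) (E : Set ι)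
    (hn : n ≤ Dᶜ.ncard + (c '' Dᶜ \ E).ncard) :
    ExtVanishes (maximalHomogeneousIdeal K V) n (PolyRing K V ⧸ colouredIdeal K c D E) := by
  induction n generalizing D E with
  | zero => exact fun k i hi => absurd hi (Nat.not_lt_zero i)
  | succ n ih =>
  obtain ⟨v, hv⟩ : ∃ v, v ∉ D := by
    by_contra! h
    have : Dᶜ = ∅ := Set.compl_empty_iff.2 (Set.eq_univ_of_forall h)
    simp [this] at hn
  have hfin : ∀ (s : Set V) (t : Set ι), (c '' s \ t).Finite :=
    fun s t => (s.toFinite.image c).sdiff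
  have hD : (insert v D)ᶜ.ncard + 1 = Dᶜ.ncard := by
    rw [← Set.ncard_sdiff_singleton_add_one (s := Dᶜ) hv (Set.toFinite _)]
    congr 2
    ext w; simp [and_comm]
  by_cases hE : c v ∈ E
  -- Here x_v is already in the ideal, so killing the regular element y_v deletes v; one vertex is
  -- lost, and no colour outside E.
  · refine ExtVanishes.quotient_of_regular (y_mem_maximalHomogeneousIdeal v)
      (fun a => mem_of_y_mul_mem hv) ?_
    rw [colouredIdeal_sup_y hE]
    refine ih _ _ ?_
    have : c '' (insert v D)ᶜ \ E = c '' Dᶜ \ E := by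
      ext k
      constructor
      · rintro ⟨⟨w, hw, rfl⟩, hk⟩
        exact ⟨⟨w, fun h => hw (Or.inr h), rfl⟩, hk⟩
      · rintro ⟨⟨w, hw, rfl⟩, hk⟩
        refine ⟨⟨w, ?_, rfl⟩, hk⟩
        rintro (rfl | h)
        exacts [hk hE, hw h]
    rw [this]; omega
  have hcol : (c '' Dᶜ \ insert (c v) E).ncard + 1 = (c '' Dᶜ \ E).ncard := by
    rw [← Set.ncard_sdiff_singleton_add_one (s := c '' Dᶜ \ E) (a := c v) ⟨⟨v, hv, rfl⟩, hE⟩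
      (hfin _ _)]
    congr 2
    ext k; simp only [Set.mem_sdiff, Set.mem_insert_iff, Set.mem_singleton_iff]; tauto
  have hinsert : ExtVanishes (maximalHomogeneousIdeal K V) n
      (PolyRing K V ⧸ colouredIdeal K c D (insert (c v) E)) := ih _ _ (by omega)
  refine ExtVanishes.quotient_of_regular (x_mem_maximalHomogeneousIdeal v)
    (fun a => mem_of_x_mul_mem hv hE) ?_
  -- If v is the last vertex of its colour, killing x_v just moves that colour into E. Otherwise the
  -- colon by y_v costs one colour, while killing y_v too costs one vertex; the colour survives at
  -- w. Either way the bound drops by exactly one.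
  by_cases huniq : ∀ w ∉ D, c w = c v → w = v
  · rwa [colouredIdeal_sup_x_of_unique huniq]
  · push Not at huniq
    obtain ⟨w, hwD, hwc, hwv⟩ := huniq
    refine ExtVanishes.quotient_of_colon (y_mul_mem_colouredIdeal_sup_x_iff hv) hinsert ?_
    rw [colouredIdeal_sup_x_sup_y]
    refine ih _ _ ?_
    have : c '' Dᶜ \ E ⊆ c '' (insert v D)ᶜ \ E := by
      rintro _ ⟨⟨j, hj, rfl⟩, hk⟩
      refine ⟨?_, hk⟩
      by_cases hjv : j = v
      · subst hjv
        exact ⟨w, fun h => h.elim hwv hwD, hwc⟩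
      · exact ⟨j, fun h => h.elim hjv hj, rfl⟩
    have := Set.ncard_le_ncard this (hfin _ _)
    omega

end ColouredDepth

/-! ### Disjoint unions of complete graphs, and the induction on non-edges. -/

section Main

variable {K : Type w} [Field K] {V W : Type u}

/-- Colours are the components. Vertices outside the range of f get the default colour `none`,
harmlessly: their variables already lie in the ideal. -/
theorem embeddedIdeal_eq_colouredIdeal {f : W → V} (hf : Function.Injective f) {G : SimpleGraph W}
    {t : ℕ} {n : Fin t → ℕ} (e : G ≃g disjointUnionComplete n) :
    embeddedIdeal K f G =
      colouredIdeal K (Function.extend f (fun w => some (e w).1) fun _ => none)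
        (Set.range f)ᶜ ∅ := by
  set c : V → Option (Fin t) := Function.extend f (fun w => some (e w).1) fun _ => none
  have hc : ∀ w, c (f w) = some (e w).1 := fun w => hf.extend_apply _ _ w
  refine le_antisymm (embeddedIdeal_le (fun u hu => x_mem_colouredIdeal hu)
    (fun u hu => y_mem_colouredIdeal hu) fun i j hij => minor_mem_colouredIdeal ?_)
    (colouredIdeal_le (fun u hu => x_mem_embeddedIdeal hu) (fun u hu => y_mem_embeddedIdeal hu)
      (fun u hu => hu.elim) fun i j hij => ?_)
  · rw [hc, hc, ((e.map_adj_iff (v := i) (w := j)).2 hij).2]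
  · by_cases hi : i ∈ Set.range f
    · by_cases hj : j ∈ Set.range f
      · obtain ⟨a, rfl⟩ := hi
        obtain ⟨b, rfl⟩ := hj
        by_cases hab : a = b
        · subst hab; simp [minor]
        · refine minor_mem_embeddedIdeal (e.map_adj_iff.1 ⟨fun h => hab (e.injective h), ?_⟩)
          rw [hc, hc] at hij
          exact Option.some_injective _ hij
      · exact minor_mem_swap
          (minor_mem_of_x_mem_of_y_mem (x_mem_embeddedIdeal hj) (y_mem_embeddedIdeal hj) _)
    · exact minor_mem_of_x_mem_of_y_mem (x_mem_embeddedIdeal hi) (y_mem_embeddedIdeal hi) _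

theorem extVanishes_of_isDisjointUnionComplete [Finite V] {f : W → V}
    (hf : Function.Injective f) {G : SimpleGraph W} {t : ℕ} {n : Fin t → ℕ}
    (h : IsDisjointUnionComplete G n) :
    ExtVanishes (maximalHomogeneousIdeal K V) (t + ∑ i, n i)
      (PolyRing K V ⧸ embeddedIdeal K f G) := by
  obtain ⟨hn, ⟨e⟩⟩ := h
  rw [embeddedIdeal_eq_colouredIdeal hf e]
  refine extVanishes_colouredIdeal _ _ _ ?_
  set c : V → Option (Fin t) := Function.extend f (fun w => some (e w).1) fun _ => none
  have hc : ∀ w, c (f w) = some (e w).1 := fun w => hf.extend_apply _ _ w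
  have h₁ : (Set.range f).ncard = ∑ i, n i := by
    rw [← Set.image_univ, Set.ncard_image_of_injective _ hf, Set.ncard_univ,
      Nat.card_congr e.toEquiv]
    simp
  have h₂ : c '' Set.range f = Set.range some := by
    ext k
    constructor
    · rintro ⟨_, ⟨w, rfl⟩, rfl⟩
      exact ⟨_, (hc w).symm⟩
    · rintro ⟨i, rfl⟩
      -- Since n_i ≥ 1, each component has a vertex, so all t colours occur.
      exact ⟨_, ⟨e.symm ⟨i, ⟨0, hn i⟩⟩, rfl⟩, by rw [hc, e.apply_symm_apply]⟩
  have h₃ : (Set.range (some : Fin t → Option (Fin t))).ncard = t := by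
    rw [← Set.image_univ, Set.ncard_image_of_injective _ (Option.some_injective _), Set.ncard_univ]
    simp
  rw [compl_compl, Set.sdiff_empty, h₁, h₂, h₃, add_comm]

/-- The number of ordered pairs of vertices that are not adjacent. -/
def nonEdgeCount (G : SimpleGraph W) : ℕ := {p : W × W | ¬ G.Adj p.1 p.2}.ncard

/-- The map g × g injects the non-edges of G' into those of G and misses (a, b). -/
theorem nonEdgeCount_lt [Finite W] {W' : Type u} {G : SimpleGraph W} {G' : SimpleGraph W'}
    {g : W' → W} (hg : Function.Injective g) (h : ∀ i j, G.Adj (g i) (g j) → G'.Adj i j)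
    {a b : W} (hab : ¬ G.Adj a b)
    (hmiss : ∀ i j, ¬ G'.Adj i j → g i = a → g j ≠ b) :
    nonEdgeCount G' < nonEdgeCount G := by
  rw [nonEdgeCount, ← Set.ncard_image_of_injective _ (hg.prodMap hg)]
  refine Set.ncard_lt_ncard ⟨?_, fun hsub => ?_⟩ (Set.toFinite _)
  · rintro _ ⟨⟨i, j⟩, hij, rfl⟩
    exact fun hadj => hij (h _ _ hadj)
  · obtain ⟨⟨i, j⟩, hij, heq⟩ := hsub (show (a, b) ∈ _ from hab)
    exact hmiss i j hij (congrArg Prod.fst heq) (congrArg Prod.snd heq)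

/-- Diagonal pairs count as non-edges, so deleting v always loses (v, v). -/
theorem nonEdgeCount_deleteVertex_lt [Finite W] {G G' : SimpleGraph W} (h : G ≤ G') (v : W) :
    nonEdgeCount (deleteVertex G' v) < nonEdgeCount G :=
  nonEdgeCount_lt (g := ((↑) : ({v}ᶜ : Set W) → W)) Subtype.val_injective (fun _ _ hij => h hij)
    (G.irrefl (v := v)) fun i _ _ hi => absurd hi i.2

theorem nonEdgeCount_completeAt_lt [Finite W] {G : SimpleGraph W} {v : W}
    (hv : ¬ IsFreeVertex G v) : nonEdgeCount (completeAt G v) < nonEdgeCount G := by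
  simp only [IsFreeVertex, SimpleGraph.isClique_iff, Set.Pairwise] at hv
  push Not at hv
  obtain ⟨a, ha, b, hb, hab, hadj⟩ := hv
  refine nonEdgeCount_lt (g := id) Function.injective_id (fun i j hij => Or.inl hij) hadj ?_
  rintro i j hij rfl rfl
  exact hij (Or.inr ⟨hab, ha, hb⟩)

/-- The ring on V stays fixed while W and its embedding vary, so deleting vertices requires no
change of rings. -/
theorem IsDCompatible.extVanishes {ψ : ∀ (V : Type u) [Finite V], SimpleGraph V → ℕ}
    (hψ : IsDCompatible ψ) [Finite V] (N : ℕ) (W : Type u) [Finite W] (G : SimpleGraph W)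
    (hN : nonEdgeCount G = N) (f : W → V) (hf : Function.Injective f) :
    ExtVanishes (maximalHomogeneousIdeal K V) (ψ W G) (PolyRing K V ⧸ embeddedIdeal K f G) := by
  induction N using Nat.strong_induction_on generalizing W with
  | _ N ih =>
  subst hN
  by_cases hG : ∃ (t : ℕ) (n : Fin t → ℕ), IsDisjointUnionComplete G n
  · obtain ⟨t, n, h⟩ := hG
    exact (extVanishes_of_isDisjointUnionComplete hf h).mono (hψ.le_of_disjointUnion W G t n h)
  · obtain ⟨v, hv, h₁, h₂, h₃⟩ := hψ.exists_nonfree W G hG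
    have hf' : Function.Injective (f ∘ ((↑) : ({v}ᶜ : Set W) → W)) :=
      hf.comp Subtype.val_injective
    rw [← embeddedIdeal_completeAt_inf_delete v hf]
    refine ExtVanishes.quotient_inf ?_ ?_ ?_
    · exact (ih _ (nonEdgeCount_completeAt_lt hv) W _ rfl f hf).mono h₂
    · exact (ih _ (nonEdgeCount_deleteVertex_lt le_rfl v) _ _ rfl _ hf').mono h₁
    · rw [embeddedIdeal_completeAt_sup_delete v hf]
      exact (ih _ (nonEdgeCount_deleteVertex_lt (le_completeAt v) v) _ _ rfl _ hf').mono
        (by omega)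

theorem embeddedIdeal_id (G : SimpleGraph V) :
    embeddedIdeal K id G = binomialEdgeIdeal K G := by
  refine le_antisymm (embeddedIdeal_le (fun u hu => absurd ⟨u, rfl⟩ hu)
    (fun u hu => absurd ⟨u, rfl⟩ hu) fun i j h => Ideal.subset_span ⟨i, j, h, rfl⟩) ?_
  refine Ideal.span_le.2 ?_
  rintro _ ⟨i, j, h, rfl⟩
  exact minor_mem_embeddedIdeal (f := id) h

end Main
end BinomialEdge
end

theorem theorem3p2 (K : Type w) [Field K]
    (ψ : ∀ (V : Type u) [Finite V], SimpleGraph V → ℕ) (hψ : BinomialEdge.IsDCompatible ψ)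
    (V : Type u) [Finite V] (G : SimpleGraph V) :
    (ψ V G : ℕ∞) ≤
      BinomialEdge.depth (BinomialEdge.maximalHomogeneousIdeal K V)
        (BinomialEdge.PolyRing K V ⧸ BinomialEdge.binomialEdgeIdeal K G) := by
  rw [← BinomialEdge.embeddedIdeal_id]
  exact (hψ.extVanishes _ V G rfl id Function.injective_id).le_depth
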